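/- Let $\mathbb N=\{1,2,\dots\}$, let $\ell^2=\ell^2(\mathbb N;\mathbb C)$ with canonical orthonormal basis $(\varepsilon_k)_{k\ge 1}$, and write $e(x)=e^{2\pi i x}$ for $x\in\mathbb R$. There is an absolute constant $C$ such that the following holds for every bounded operator $T:\ell^2\to\ell^2$ with $0\le T\le 1$, with matrix $T_{i,j}=\langle\varepsilon_i,T\varepsilon_j\rangle$. (a) There is exactly one probability measure $\mu_T$ on the Borel sets of $\{0,1\}^{\mathbb N}$ (the determinantal measure of $T$) such that, for every finite $F\subset\mathbb N$ and every $\xi\in\{0,1\}^F$, $$\mu_T\{\omega:\ \omega_k=\xi_k\text{ for all }k\in F\}=\det\Bigl(\xi_i\delta_{i,j}+(-1)^{\xi_i}(\delta_{i,j}-T_{i,j})\Bigr)_{i,j\in F}.$$ Let $\lambda\in(0,1)$. (b) The map $\pi_\lambda(\omega)=\sum_{k=1}^\infty\omega_k\lambda^k$ is the unique continuous map $\pi:\{0,1\}^{\mathbb N}\to\mathbb R$ with $\pi(b,\omega_1,\omega_2,\dots)=\lambda\,(\pi(\omega)+b)$ for all $b\in\{0,1\}$ and all $\omega$; that is, it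 is the encoding map of the iterated function system $\tau_0(x)=\lambda x$, $\tau_1(x)=\lambda(x+1)$. (c) Let $\nu_T=\mu_T\circ\pi_\lambda^{-1}$ be the induced measure on $\mathbb R$ and $\hat\nu_T(t)=\int_{\mathbb R} e(tx)\,d\nu_T(x)$ its Fourier transform. Let $T_{F_n}=(T_{i,j})_{1\le i,j\le n}$, let $I_n$ be the $n\times n$ identity matrix, and let $D_n(\lambda t)=\operatorname{diag}\bigl(e(\lambda t)-1,\,e(\lambda^2t)-1,\dots,e(\lambda^nt)-1\bigr)$. Then for all $t\in\mathbb R$ $$\hat\nu_T(t)=\lim_{n\to\infty}\det\bigl(I_n+D_n(\lambda t)T_{F_n}\bigr).$$ (d) Moreover, up to an error of second order in $S_n=D_n(\lambda t)T_{F_n}$, uniformly in $n$, this is the exponential of the trace. Put $s_k=(e(\lambda^kt)-1)T_{k,k}$, the $k$-th diagonal entry of $S_n$. Then $\sum_k|s_k|<\infty$, and for all $t\in\mathbb R$ and all integers $n\ge 0$ $$\Bigl|\det(I_n+D_n(\lambda t)T_{F_n})-\exp\Bigl(\sum_{k=1}^n s_k\Bigr)\Bigr|\le C\Bigl(\sum_{k=1}^n|s_k|\Bigr)^2,$$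 $$\Bigl|\hat\nu_T(t)-\exp\Bigl(\sum_{k=1}^\infty s_k\Bigr)\Bigr|\le C\Bigl(\sum_{k=1}^\infty|s_k|\Bigr)^2,$$ $$\Bigl|\hat\nu_T(t)-\exp\Bigl(\sum_{k=1}^n s_k\Bigr)\Bigr|\le C\Bigl(\Bigl(\frac{\lambda|t|}{1-\lambda}\Bigr)^2+\frac{\lambda^{n+1}|t|}{1-\lambda}\Bigr).$$ -/

import Mathlib

open Filter Topology MeasureTheory

namespace DetFourier

noncomputable section

/-- The complex Hilbert space `ℓ²`; the coordinates `1, 2, 3, …` are indexed here by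
`0, 1, 2, …`, so the index `k : ℕ` stands for the coordinate number `k + 1`. -/
abbrev EllTwo : Type := lp (fun _ : ℕ => ℂ) 2

/-- The product space `{0,1}^ℕ`, with the product (Borel) σ-algebra and product topology. -/
abbrev BinarySeq : Type := ℕ → Bool

/-- `e(x) = exp(2πix)`. -/
def e (x : ℝ) : ℂ := Complex.exp (2 * Real.pi * Complex.I * x)

/-- The matrix entry `⟨ε_i, T ε_j⟩` in the canonical orthonormal basis of `ℓ²`. -/
def entry (T : EllTwo →L[ℂ] EllTwo) (i j : ℕ) : ℂ :=
  inner ℂ (lp.single 2 i (1 : ℂ) : EllTwo) (T (lp.single 2 j (1 : ℂ)))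

/-- The cylinder set `G(ξ)` of all `ω` with `ω|_F = ξ`. -/
def cyl (F : Finset ℕ) (ξ : F → Bool) : Set BinarySeq := {ω | ∀ k : F, ω k = ξ k}

/-- The matrix `W(ξ)_{ij} = ξ_i δ_{ij} + (-1)^{ξ_i} (δ_{ij} - T_{ij})`, `i, j ∈ F`. -/
def W (T : EllTwo →L[ℂ] EllTwo) (F : Finset ℕ) (ξ : F → Bool) : Matrix F F ℂ :=
  Matrix.of fun i j =>
    ((ξ i).toNat : ℂ) * (1 : Matrix F F ℂ) i j +
      (-1) ^ (ξ i).toNat * ((1 : Matrix F F ℂ) i j - entry T i j)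

/-- `μ` is the determinantal measure of `T`: a probability measure on `{0,1}^ℕ` with
`μ(G(ξ)) = det W(ξ)` for all cylinder sets. -/
structure IsDeterminantalMeasure (T : EllTwo →L[ℂ] EllTwo) (μ : Measure BinarySeq) : Prop where
  isProbabilityMeasure : IsProbabilityMeasure μ
  measure_cyl : ∀ (F : Finset ℕ) (ξ : F → Bool), (μ.real (cyl F ξ) : ℂ) = (W T F ξ).det

/-- The right shift `σ_b(ω₁, ω₂, …) = (b, ω₁, ω₂, …)`. -/
def shift (b : Bool) (ω : BinarySeq) : BinarySeq
  | 0 => b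
  | k + 1 => ω k

/-- The affine maps `τ_b(x) = lam (x + b)`, `b ∈ {0,1}`. -/
def ifsMap (lam : ℝ) (b : Bool) (x : ℝ) : ℝ := lam * (x + b.toNat)

/-- Encoding maps of the iterated function system `{τ_0, τ_1}`. -/
def IsEncodingMap (lam : ℝ) (p : BinarySeq → ℝ) : Prop :=
  Continuous p ∧ ∀ (b : Bool) (ω : BinarySeq), p (shift b ω) = ifsMap lam b (p ω)

/-- `π_lam(ω) = ∑_{k ≥ 1} ω_k lam^k`. -/
def encode (lam : ℝ) (ω : BinarySeq) : ℝ := ∑' k : ℕ, ((ω k).toNat : ℝ) * lam ^ (k + 1)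

/-- The induced measure `μ ∘ π_lam⁻¹` on `ℝ`. -/
def induced (lam : ℝ) (μ : Measure BinarySeq) : Measure ℝ := μ.map (encode lam)

/-- The Fourier transform of a measure on `ℝ`, with kernel `e(tx)`. -/
def fourier (ν : Measure ℝ) (t : ℝ) : ℂ := ∫ x, e (t * x) ∂ν

/-- `D_n(lam t) = diag(e(lam t) - 1, …, e(lam^n t) - 1)`. -/
def D (lam t : ℝ) (n : ℕ) : Matrix (Fin n) (Fin n) ℂ :=
  Matrix.diagonal fun k => e (lam ^ ((k : ℕ) + 1) * t) - 1

/-- The restricted matrix `T_{F_n}`, `F_n = {1, …, n}`. -/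
def trunc (T : EllTwo →L[ℂ] EllTwo) (n : ℕ) : Matrix (Fin n) (Fin n) ℂ :=
  Matrix.of fun i j => entry T i j

/-- The `(k+1)`-st diagonal entry `(e(lam^{k+1} t) - 1) T_{k+1,k+1}` of `D_n(lam t) T_{F_n}`. -/
def diagTerm (T : EllTwo →L[ℂ] EllTwo) (lam t : ℝ) (k : ℕ) : ℂ :=
  (e (lam ^ (k + 1) * t) - 1) * entry T k k

end

end DetFourier

/-! Row `i` of the matrix defining a cylinder probability depends only on `ξ i`: it is the row of
`T` if the digit is 1 and the row of `1 - T` otherwise. Determinants are multilinear in rows, so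
summing over all `ξ` against product weights gives a single determinant
(`sum_prod_mul_det_cylMatrix`). Suitable weights yield the total mass, the consistency of marginals
and, later, the expectation of any product of functions of single digits. Nonnegativity of the
cylinder determinants follows from `0 ≤ T ≤ 1`, and Kolmogorov extension then gives the measure.

The partial characters `∏ e(t ω_k lam^k)` are such products, and their expectation is `det (1 + D
T)`; dominated convergence gives the Fourier transform.

For the asymptotics, each factor is `1 + z_k` with modulus 1 and `z_k = ω_k (e(lam^k t) - 1)`.
Expanding the product to first order leaves an error controlled by pairs `j < k`. Distinct digits
are negatively correlated, so the expected error is at most `(∑ |s_k|)^2`. The exponential of the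
trace has the same first-order expansion, and all quantities compared have modulus at most 1, which
handles large sums. -/

namespace DetFourier

open Matrix
open scoped ComplexOrder

/-- The matrix `ξ_i δ_{ij} + (-1)^{ξ_i} (δ_{ij} - A_{ij})` of a finite matrix `A`. -/
noncomputable def cylMatrix {ι : Type*} [DecidableEq ι] (A : Matrix ι ι ℂ) (ξ : ι → Bool) :
    Matrix ι ι ℂ :=
  Matrix.of fun i j =>
    ((ξ i).toNat : ℂ) * (1 : Matrix ι ι ℂ) i j +
      (-1) ^ (ξ i).toNat * ((1 : Matrix ι ι ℂ) i j - A i j)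

/-! ### Determinants of finite matrices: generating function, consistency, nonnegativity. -/

section Finite

variable {ι κ : Type*} [Fintype ι] [DecidableEq ι] [Fintype κ] [DecidableEq κ]

/-- Multilinearity of the determinant in its rows: row `i` of `cylMatrix A ξ` is that of `A` or of
`1 - A` according to `ξ i`, so the sum over `ξ` can be taken row by row. -/
lemma sum_prod_mul_det_cylMatrix (A : Matrix ι ι ℂ) (w : ι → Bool → ℂ) :
    ∑ ξ : ι → Bool, (∏ i, w i (ξ i)) * (cylMatrix A ξ).det =
      (Matrix.of fun i j =>
        w i false * ((1 : Matrix ι ι ℂ) i j - A i j) + w i true * A i j).det := by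
  have h1 : (Matrix.of fun i j =>
        w i false * ((1 : Matrix ι ι ℂ) i j - A i j) + w i true * A i j) =
      fun i => ∑ b : Bool, w i b • (fun j =>
        if b then A i j else (1 : Matrix ι ι ℂ) i j - A i j) := by
    ext i j
    simp [add_comm]
  have h2 := (Matrix.detRowAlternating (R := ℂ) (n := ι)).toMultilinearMap.map_sum
    (fun i (b : Bool) => w i b • (fun j =>
        if b then A i j else (1 : Matrix ι ι ℂ) i j - A i j))
  rw [h1]
  refine Eq.trans ?_ h2.symm
  refine Finset.sum_congr rfl fun ξ _ => ?_
  rw [MultilinearMap.map_smul_univ, smul_eq_mul]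
  congr 1
  change _ = Matrix.det _
  congr 1
  ext i j
  rcases h : ξ i <;> simp [cylMatrix, h]

lemma sum_det_cylMatrix (A : Matrix ι ι ℂ) : ∑ ξ : ι → Bool, (cylMatrix A ξ).det = 1 := by
  have h := sum_prod_mul_det_cylMatrix A fun _ _ => 1
  simp only [Finset.prod_const_one, one_mul, sub_add_cancel] at h
  rw [h]
  exact Matrix.det_one

/-- Consistency of the family of determinants under passing to principal submatrices. -/
lemma sum_det_cylMatrix_of_comp_eq (A : Matrix ι ι ℂ) (f : κ → ι) (hf : Function.Injective f)
    (η : κ → Bool) :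
    (∑ ξ : ι → Bool, if ξ ∘ f = η then (cylMatrix A ξ).det else 0) =
      (cylMatrix (A.submatrix f f) η).det := by
  classical
  -- These weights multiply to the indicator of `ξ ∘ f = η`. An index outside the range of `f` has
  -- both weights 1, so its row becomes a row of the identity and the determinant is block
  -- triangular.
  have h := sum_prod_mul_det_cylMatrix A fun i b => if ∀ k, f k = i → b = η k then 1 else 0
  have h1 : ∀ ξ : ι → Bool,
      (∏ i, if ∀ k, f k = i → ξ i = η k then (1 : ℂ) else 0) =
        if ξ ∘ f = η then 1 else 0 := by
    intro ξ
    rw [Finset.prod_boole]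
    congr 1
    simp only [Finset.mem_univ, true_imp_iff, funext_iff, Function.comp, eq_iff_iff]
    exact ⟨fun h k => h _ k rfl, fun h i k hk => hk ▸ h k⟩
  simp only [h1, ite_mul, one_mul, zero_mul] at h
  rw [h, Matrix.twoBlockTriangular_det _ (fun i => ∃ k, f k = i)]
  · have h2 : (Matrix.toSquareBlockProp (Matrix.of fun i j =>
        (if ∀ k, f k = i → false = η k then (1 : Matrix ι ι ℂ) i j - A i j else 0) +
        (if ∀ k, f k = i → true = η k then A i j else 0))
        (fun i => ¬ ∃ k, f k = i)) = 1 := by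
      ext ⟨i, hi⟩ ⟨j, hj⟩
      have h3 : ∀ k, f k ≠ i := fun k hk => hi ⟨k, hk⟩
      simp [Matrix.toSquareBlockProp_def, h3, Matrix.one_apply]
    rw [h2, Matrix.det_one, mul_one]
    let g : κ ≃ {i // ∃ k, f k = i} := Equiv.ofInjective f hf
    refine (Matrix.det_submatrix_equiv_self g _).symm.trans ?_
    congr 1
    ext k l
    have hg : ∀ m, (g m : ι) = f m := fun _ => rfl
    rcases hk : η k <;>
      simp [hg, Matrix.toSquareBlockProp_def, hk, cylMatrix, Matrix.one_apply, hf.eq_iff]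
  · intro i hi j hj
    have h3 : ∀ k, f k ≠ i := fun k hk => hi ⟨k, hk⟩
    have : i ≠ j := fun h => hi (h ▸ hj)
    simp [h3, Matrix.one_apply, this]

/-- The matrix whose rows are those of the identity where `ξ_i = 1` and those of `B` elsewhere
has nonnegative determinant. -/
lemma det_mixed_rows_nonneg {B : Matrix ι ι ℂ} (hB : B.PosSemidef) (ξ : ι → Bool) :
    0 ≤ (1 + diagonal (fun i => if ξ i then (0 : ℂ) else 1) * (B - 1)).det := by
  set P : Matrix ι ι ℂ := diagonal (fun i => if ξ i then (0 : ℂ) else 1) with hP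
  have hPP : P * P = P := by
    rw [hP, diagonal_mul_diagonal]
    congr 1
    ext i
    split_ifs <;> simp
  have hPh : Pᴴ = P := by
    rw [hP, diagonal_conjTranspose]
    congr 1
    ext i
    simp only [Pi.star_apply]
    split_ifs <;> simp
  -- Write the projection as `P * P` and move one factor to the right by `det (1 + XY) = det (1 +
  -- YX)`; the result is a sum of two positive semidefinite matrices.
  have h1 : (1 + P * (B - 1)).det = (1 - P + P * B * P).det := by
    conv_lhs => rw [← hPP, Matrix.mul_assoc, Matrix.det_one_add_mul_comm]
    congr 1
    rw [Matrix.mul_sub, Matrix.sub_mul, Matrix.mul_one, hPP]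
    abel
  rw [h1]
  refine PosSemidef.det_nonneg (PosSemidef.add ?_ ?_)
  · rw [hP, ← diagonal_one, diagonal_sub]
    refine PosSemidef.diagonal fun i => ?_
    simp only [Pi.zero_apply]
    split_ifs <;> simp
  · have := hB.conjTranspose_mul_mul_same P
    rwa [hPh] at this

/-- Since `1 - A = (A⁻¹ - 1) A`, a factor `A` splits off on the right, leaving a matrix whose rows
come from the identity or from `A⁻¹ - 1`, which is positive semidefinite. -/
lemma det_cylMatrix_nonneg_of_posDef {A : Matrix ι ι ℂ} (hA : A.PosDef)
    (hA1 : (1 - A).PosSemidef) (ξ : ι → Bool) : 0 ≤ (cylMatrix A ξ).det := by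
  have hu : IsUnit A.det := (Matrix.isUnit_iff_isUnit_det A).1 hA.isUnit
  have hB : (A⁻¹ - 1).PosSemidef := by
    have h1 : A⁻¹ - 1 = (1 - A) + (1 - A)ᴴ * A⁻¹ * (1 - A) := by
      rw [hA1.isHermitian.eq]
      simp only [Matrix.sub_mul, Matrix.mul_sub, Matrix.one_mul, Matrix.mul_one,
        Matrix.mul_nonsing_inv A hu, Matrix.nonsing_inv_mul A hu]
      abel
    rw [h1]
    exact hA1.add (hA.inv.posSemidef.conjTranspose_mul_mul_same _)
  have h2 : cylMatrix A ξ =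
      (1 + diagonal (fun i => if ξ i then (0 : ℂ) else 1) * ((A⁻¹ - 1) - 1)) * A := by
    have h3 : (A⁻¹ - 1 - 1) * A = 1 - A - A := by
      simp only [Matrix.sub_mul, Matrix.one_mul, Matrix.nonsing_inv_mul A hu]
    rw [Matrix.add_mul, Matrix.mul_assoc, h3]
    ext i j
    rcases h : ξ i <;> simp [cylMatrix, h, Matrix.diagonal_mul]
  rw [h2, Matrix.det_mul]
  exact mul_nonneg (det_mixed_rows_nonneg hB ξ) hA.posSemidef.det_nonneg

/-- Perturb to the positive definite matrix `(1 - r) A + r`, which still lies below 1, and let `r →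
0+`. -/
lemma det_cylMatrix_nonneg {A : Matrix ι ι ℂ} (hA : A.PosSemidef)
    (hA1 : (1 - A).PosSemidef) (ξ : ι → Bool) : 0 ≤ (cylMatrix A ξ).det := by
  have hcont : Continuous fun r : ℝ =>
      (cylMatrix ((1 - (r : ℂ)) • A + (r : ℂ) • (1 : Matrix ι ι ℂ)) ξ).det := by
    refine Continuous.matrix_det ?_
    refine continuous_matrix fun i j => ?_
    simp only [cylMatrix, Matrix.of_apply, Matrix.add_apply, Matrix.smul_apply, smul_eq_mul]
    fun_prop
  have hlim := (hcont.tendsto 0).mono_left (nhdsWithin_le_nhds (s := Set.Ioi 0))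
  simp only [Complex.ofReal_zero, sub_zero, one_smul, zero_smul, add_zero] at hlim
  refine ge_of_tendsto hlim ?_
  filter_upwards [Ioo_mem_nhdsGT (show (0 : ℝ) < 1 by norm_num)] with r hr
  have hr0 : (0 : ℂ) < r := by exact_mod_cast hr.1
  have hr1 : (0 : ℂ) ≤ 1 - r := by
    rw [← Complex.ofReal_one, ← Complex.ofReal_sub]
    exact_mod_cast (sub_pos.2 hr.2).le
  refine det_cylMatrix_nonneg_of_posDef ?_ ?_ ξ
  · exact PosDef.posSemidef_add (hA.smul hr1) (PosDef.one.smul hr0)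
  · have : (1 : Matrix ι ι ℂ) - ((1 - (r : ℂ)) • A + (r : ℂ) • (1 : Matrix ι ι ℂ)) =
        (1 - (r : ℂ)) • (1 - A) := by
      module
    rw [this]
    exact hA1.smul hr1

end Finite

/-! ### Principal submatrices of the operator. -/

section Compression

variable {ι : Type*}

/-- The compression of `T` to the coordinates `v i`. -/
noncomputable def compression (T : EllTwo →L[ℂ] EllTwo) (v : ι → ℕ) :
    Matrix ι ι ℂ :=
  Matrix.of fun i j => entry T (v i) (v j)

lemma compression_posSemidef [Fintype ι] {T : EllTwo →L[ℂ] EllTwo} (hT : 0 ≤ T) (v : ι → ℕ) :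
    (compression T v).PosSemidef := by
  have hp := (ContinuousLinearMap.nonneg_iff_isPositive T).1 hT
  refine PosSemidef.of_dotProduct_mulVec_nonneg ?_ fun x => ?_
  · ext i j
    simp only [compression, entry, conjTranspose_apply, of_apply]
    rw [← hp.isSelfAdjoint.adjoint_eq, ContinuousLinearMap.adjoint_inner_right,
      RCLike.star_def, inner_conj_symm, hp.isSelfAdjoint.adjoint_eq]
  · have h := hp.inner_nonneg_right (∑ i, x i • (lp.single 2 (v i) (1 : ℂ) : EllTwo))
    simp only [map_sum, map_smul, sum_inner, inner_sum, inner_smul_left, inner_smul_right] at h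
    convert h using 1
    simp only [dotProduct, mulVec, Finset.mul_sum, compression, entry, of_apply, Pi.star_apply,
      RCLike.star_def]
    rw [Finset.sum_comm]
    refine Finset.sum_congr rfl fun i _ => Finset.sum_congr rfl fun j _ => ?_
    ring

lemma inner_single_single (i j : ℕ) :
    inner ℂ (lp.single 2 i (1 : ℂ) : EllTwo) (lp.single 2 j (1 : ℂ) : EllTwo) =
      if i = j then 1 else 0 := by
  rw [lp.inner_single_left]
  simp [lp.single_apply, Pi.single_apply]

lemma compression_one_sub [DecidableEq ι] (T : EllTwo →L[ℂ] EllTwo) {v : ι → ℕ}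
    (hv : Function.Injective v) : compression (1 - T) v = 1 - compression T v := by
  ext i j
  simp [compression, entry, inner_single_single, Matrix.one_apply, hv.eq_iff]

lemma one_sub_compression_posSemidef [Fintype ι] [DecidableEq ι] {T : EllTwo →L[ℂ] EllTwo} (hT : T ≤ 1)
    {v : ι → ℕ} (hv : Function.Injective v) : (1 - compression T v).PosSemidef := by
  rw [← compression_one_sub T hv]
  exact compression_posSemidef (sub_nonneg.2 hT) v

end Compression

/-! ### Kolmogorov extension on the Cantor space. -/

section KolmogorovExtension

variable {P : ∀ J : Finset ℕ, Measure (∀ _ : J, Bool)}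

lemma isClosed_of_mem_measurableCylinders {s : Set BinarySeq}
    (hs : s ∈ measurableCylinders fun _ : ℕ => Bool) : IsClosed s := by
  obtain ⟨I, S, -, rfl⟩ := (mem_measurableCylinders _).1 hs
  exact (isClosed_discrete S).preimage (by fun_prop)

/-- Cylinders are closed in a compact space, so a decreasing sequence of them with empty
intersection is eventually empty. This is the continuity at `∅` that gives σ-additivity. -/
lemma projectiveFamilyContent_tendsto_zero (hP : IsProjectiveMeasureFamily (α := fun _ : ℕ => Bool) P)
    {A : ℕ → Set BinarySeq} (hA : ∀ n, A n ∈ measurableCylinders fun _ : ℕ => Bool)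
    (hanti : Antitone A) (hinter : ⋂ n, A n = ∅) :
    Tendsto (fun n => projectiveFamilyContent hP (A n)) atTop (𝓝 0) := by
  obtain ⟨N, hN⟩ : ∃ N, A N = ∅ := by
    by_contra! h
    have := IsCompact.nonempty_iInter_of_sequence_nonempty_isCompact_isClosed A
      (fun n => hanti n.le_succ) h
      (isClosed_of_mem_measurableCylinders (hA 0)).isCompact
      (fun n => isClosed_of_mem_measurableCylinders (hA n))
    simp [hinter] at this
  refine tendsto_const_nhds.congr' ?_
  filter_upwards [eventually_ge_atTop N] with n hn
  have hn' : A n = ∅ := Set.subset_empty_iff.1 (hN ▸ hanti hn)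
  rw [hn', addContent_empty]

/-- Kolmogorov extension for consistent families of finite measures on finite powers of `Bool`. -/
lemma exists_isProjectiveLimit [∀ J, IsFiniteMeasure (P J)]
    (hP : IsProjectiveMeasureFamily (α := fun _ : ℕ => Bool) P) :
    ∃ μ : Measure BinarySeq, IsProjectiveLimit (α := fun _ : ℕ => Bool) μ P := by
  have hsub : (projectiveFamilyContent hP).IsSigmaSubadditive := by
    refine isSigmaSubadditive_of_addContent_iUnion_eq_tsum
      isSetRing_measurableCylinders fun f hf hU hd => ?_
    exact addContent_iUnion_eq_sum_of_tendsto_zero isSetRing_measurableCylinders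
      _ (fun s _ => projectiveFamilyContent_ne_top _)
      (fun _ => projectiveFamilyContent_tendsto_zero hP) hf hU hd
  refine ⟨(projectiveFamilyContent hP).measure isSetSemiring_measurableCylinders
    generateFrom_measurableCylinders.ge hsub, fun I => ?_⟩
  ext s hs
  rw [Measure.map_apply (Finset.measurable_restrict (X := fun _ : ℕ => Bool) I) hs,
    AddContent.measure_eq, ← cylinder, projectiveFamilyContent_cylinder hP hs]
  · exact generateFrom_measurableCylinders.symm
  · exact cylinder_mem_measurableCylinders _ _ hs

end KolmogorovExtension

/-! ### Existence and uniqueness of the determinantal measure. -/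

section Existence

variable {T : EllTwo →L[ℂ] EllTwo}

/-- The marginal on the coordinates in `F` of the determinantal measure of `T`. -/
noncomputable def marginal (T : EllTwo →L[ℂ] EllTwo) (F : Finset ℕ) : Measure (F → Bool) :=
  ∑ ξ : F → Bool, ENNReal.ofReal (W T F ξ).det.re • Measure.dirac ξ

lemma W_eq_cylMatrix (T : EllTwo →L[ℂ] EllTwo) (F : Finset ℕ) (ξ : F → Bool) :
    W T F ξ = cylMatrix (compression T ((↑) : F → ℕ)) ξ := rfl

lemma det_W_nonneg (h0 : 0 ≤ T) (h1 : T ≤ 1) (F : Finset ℕ) (ξ : F → Bool) :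
    0 ≤ (W T F ξ).det := by
  rw [W_eq_cylMatrix]
  exact det_cylMatrix_nonneg (compression_posSemidef h0 _)
    (one_sub_compression_posSemidef h1 Subtype.val_injective) ξ

lemma marginal_apply (F : Finset ℕ) (s : Set (F → Bool)) [DecidablePred (· ∈ s)] :
    marginal T F s = ∑ ξ : F → Bool, if ξ ∈ s then ENNReal.ofReal (W T F ξ).det.re else 0 := by
  simp [marginal, Measure.finsetSum_apply, Set.indicator_apply, Measure.dirac_apply]

lemma marginal_singleton (F : Finset ℕ) (ξ : F → Bool) :
    marginal T F {ξ} = ENNReal.ofReal (W T F ξ).det.re := by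
  classical
  simp [marginal_apply]

instance (F : Finset ℕ) : IsFiniteMeasure (marginal T F) := by
  classical
  refine ⟨?_⟩
  rw [marginal_apply]
  exact ENNReal.sum_lt_top.2 fun ξ _ => by simp

lemma isProbabilityMeasure_marginal (h0 : 0 ≤ T) (h1 : T ≤ 1) (F : Finset ℕ) :
    IsProbabilityMeasure (marginal T F) := by
  classical
  refine ⟨?_⟩
  rw [marginal_apply]
  simp only [Set.mem_univ, if_true]
  rw [← ENNReal.ofReal_sum_of_nonneg
    fun ξ _ => (Complex.nonneg_iff.1 (det_W_nonneg h0 h1 F ξ)).1, ← Complex.re_sum]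
  simp only [W_eq_cylMatrix]
  rw [sum_det_cylMatrix]
  simp

lemma isProjectiveMeasureFamily_marginal (h0 : 0 ≤ T) (h1 : T ≤ 1) :
    IsProjectiveMeasureFamily (α := fun _ : ℕ => Bool) (marginal T) := by
  classical
  intro I J hJI
  refine Measure.ext_of_singleton fun η => ?_
  rw [Measure.map_apply (Finset.measurable_restrict₂ (X := fun _ : ℕ => Bool) hJI)
      (measurableSet_singleton η),
    marginal_singleton, marginal_apply]
  have hf : Function.Injective (fun j : J => (⟨j, hJI j.2⟩ : I)) := fun a b h =>
    Subtype.ext (Subtype.mk.inj h)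
  have h := sum_det_cylMatrix_of_comp_eq (compression T ((↑) : I → ℕ)) _ hf η
  rw [W_eq_cylMatrix,
    show compression T ((↑) : J → ℕ) = (compression T ((↑) : I → ℕ)).submatrix
      (fun j : J => (⟨j, hJI j.2⟩ : I)) (fun j : J => (⟨j, hJI j.2⟩ : I)) from rfl,
    ← h, Complex.re_sum, ENNReal.ofReal_sum_of_nonneg]
  · refine Finset.sum_congr rfl fun ξ _ => ?_
    have : ξ ∈ (Finset.restrict₂ (π := fun _ : ℕ => Bool) hJI ⁻¹' {η} : Set (I → Bool)) ↔
      ξ ∘ (fun j : J => (⟨j, hJI j.2⟩ : I)) = η := Iff.rfl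
    by_cases hξ : ξ ∘ (fun j : J => (⟨j, hJI j.2⟩ : I)) = η
    · rw [if_pos (this.2 hξ), if_pos hξ, W_eq_cylMatrix]
    · rw [if_neg (mt this.1 hξ), if_neg hξ, Complex.zero_re, ENNReal.ofReal_zero]
  · intro ξ _
    split_ifs
    · exact (Complex.nonneg_iff.1 (det_W_nonneg h0 h1 I ξ)).1
    · simp

lemma cyl_eq_preimage (F : Finset ℕ) (ξ : F → Bool) : cyl F ξ = F.restrict (π := fun _ : ℕ => Bool) ⁻¹' {ξ} := by
  ext ω
  simp [cyl, funext_iff]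

/-- A measure on the finite set `F → Bool` is determined by its atoms, so the cylinder formula is
exactly the projective limit condition; existence and uniqueness transfer from there. -/
lemma isDeterminantalMeasure_iff (h0 : 0 ≤ T) (h1 : T ≤ 1) (μ : Measure BinarySeq) :
    IsDeterminantalMeasure T μ ↔ IsProjectiveLimit (α := fun _ : ℕ => Bool) μ (marginal T) := by
  have hm : ∀ (F : Finset ℕ) (ξ : F → Bool),
      μ (cyl F ξ) = (μ.map (F.restrict (π := fun _ : ℕ => Bool))) {ξ} := fun F ξ => by
    rw [Measure.map_apply (Finset.measurable_restrict (X := fun _ : ℕ => Bool) F) (measurableSet_singleton ξ),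
      cyl_eq_preimage]
  -- The complex order makes a nonnegative determinant real, so nothing is lost by using real parts
  -- in `marginal`.
  have hW : ∀ (F : Finset ℕ) (ξ : F → Bool), (((W T F ξ).det.re : ℝ) : ℂ) = (W T F ξ).det :=
    fun F ξ => (Complex.eq_re_of_ofReal_le (r := 0) (by simpa using det_W_nonneg h0 h1 F ξ)).symm
  have hW0 : ∀ (F : Finset ℕ) (ξ : F → Bool), 0 ≤ (W T F ξ).det.re :=
    fun F ξ => (Complex.nonneg_iff.1 (det_W_nonneg h0 h1 F ξ)).1
  constructor
  · intro h F
    have := h.isProbabilityMeasure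
    refine Measure.ext_of_singleton fun ξ => ?_
    rw [← hm, marginal_singleton, ← ENNReal.ofReal_toReal (measure_ne_top μ (cyl F ξ))]
    congr 1
    have := h.measure_cyl F ξ
    rw [← hW] at this
    exact_mod_cast this
  · intro h
    have := isProbabilityMeasure_marginal h0 h1
    refine ⟨h.isProbabilityMeasure, fun F ξ => ?_⟩
    rw [Measure.real, hm, h F, marginal_singleton, ENNReal.toReal_ofReal (hW0 F ξ), hW]

lemma existsUnique_isDeterminantalMeasure (h0 : 0 ≤ T) (h1 : T ≤ 1) :
    ∃! μ : Measure BinarySeq, IsDeterminantalMeasure T μ := by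
  obtain ⟨μ, hμ⟩ := exists_isProjectiveLimit (isProjectiveMeasureFamily_marginal h0 h1)
  exact ⟨μ, (isDeterminantalMeasure_iff h0 h1 μ).2 hμ, fun ν hν =>
    ((isDeterminantalMeasure_iff h0 h1 ν).1 hν).unique hμ⟩

end Existence

/-! ### The encoding map of the iterated function system. -/

section Encoding

variable {lam : ℝ}

lemma summable_pow_succ (h0 : 0 < lam) (h1 : lam < 1) : Summable fun k : ℕ => lam ^ (k + 1) :=
  (summable_nat_add_iff 1).2 (summable_geometric_of_lt_one h0.le h1)

lemma norm_digit_mul_pow_le (h0 : 0 < lam) (k : ℕ) (ω : BinarySeq) :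
    ‖((ω k).toNat : ℝ) * lam ^ (k + 1)‖ ≤ lam ^ (k + 1) := by
  have : 0 < lam ^ (k + 1) := by positivity
  rcases h : ω k <;> simp [this.le, abs_of_pos h0]

lemma summable_digit_mul_pow (h0 : 0 < lam) (h1 : lam < 1) (ω : BinarySeq) :
    Summable fun k : ℕ => ((ω k).toNat : ℝ) * lam ^ (k + 1) :=
  (summable_pow_succ h0 h1).of_norm_bounded fun k => norm_digit_mul_pow_le h0 k ω

lemma continuous_comp_apply {E : Type*} [TopologicalSpace E] (f : Bool → E) (k : ℕ) :
    Continuous fun ω : BinarySeq => f (ω k) :=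
  (continuous_of_discreteTopology (f := f)).comp (continuous_apply k)

lemma continuous_encode (h0 : 0 < lam) (h1 : lam < 1) : Continuous (encode lam) :=
  continuous_tsum
    (fun k => continuous_comp_apply (fun b => (b.toNat : ℝ) * lam ^ (k + 1)) k)
    (summable_pow_succ h0 h1) (norm_digit_mul_pow_le h0)

lemma encode_shift (h0 : 0 < lam) (h1 : lam < 1) (b : Bool) (ω : BinarySeq) :
    encode lam (shift b ω) = ifsMap lam b (encode lam ω) := by
  rw [encode, (summable_digit_mul_pow h0 h1 _).tsum_eq_zero_add, ifsMap, encode, mul_add,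
    ← tsum_mul_left, add_comm]
  congr 1
  · refine tsum_congr fun k => ?_
    simp only [shift]
    ring
  · simp only [shift]
    ring

/-- Uniqueness is a contraction argument: by compactness `|p - encode lam|` attains its maximum `M`,
and removing the first digit at the maximiser gives `M ≤ lam * M`, hence `M = 0`. -/
lemma isEncodingMap_iff (h0 : 0 < lam) (h1 : lam < 1) (p : BinarySeq → ℝ) :
    IsEncodingMap lam p ↔ p = encode lam := by
  constructor
  · rintro ⟨hc, hs⟩
    obtain ⟨ω₀, -, hmax⟩ := isCompact_univ.exists_isMaxOn Set.univ_nonempty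
      (f := fun ω => |p ω - encode lam ω|) ((hc.sub (continuous_encode h0 h1)).abs.continuousOn)
    have hmax' : ∀ ω, |p ω - encode lam ω| ≤ |p ω₀ - encode lam ω₀| := fun ω =>
      hmax (Set.mem_univ ω)
    have hω₀ : ω₀ = shift (ω₀ 0) fun k => ω₀ (k + 1) := by
      ext k
      cases k <;> rfl
    have hrec : |p ω₀ - encode lam ω₀| =
        lam * |p (fun k => ω₀ (k + 1)) - encode lam fun k => ω₀ (k + 1)| := by
      rw [hω₀, hs, encode_shift h0 h1, ifsMap, ifsMap, ← mul_sub, abs_mul, abs_of_pos h0]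
      simp only [add_sub_add_right_eq_sub]
      rfl
    have hle := hmax' fun k => ω₀ (k + 1)
    have hzero : |p ω₀ - encode lam ω₀| ≤ 0 := by
      nlinarith [abs_nonneg (p ω₀ - encode lam ω₀)]
    ext ω
    exact sub_eq_zero.1 (abs_nonpos_iff.1 ((hmax' ω).trans hzero))
  · rintro rfl
    exact ⟨continuous_encode h0 h1, encode_shift h0 h1⟩

end Encoding

/-! ### The character `e`. -/

section Character

lemma e_eq_exp (x : ℝ) : e x = Complex.exp (Complex.I * ((2 * Real.pi * x : ℝ) : ℂ)) := by
  rw [e]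
  congr 1
  push_cast
  ring

lemma e_zero : e 0 = 1 := by simp [e]

lemma e_sum {ι : Type*} (s : Finset ι) (f : ι → ℝ) : e (∑ i ∈ s, f i) = ∏ i ∈ s, e (f i) := by
  simp only [e, ← Complex.exp_sum, Complex.ofReal_sum, Finset.mul_sum]

lemma norm_e (x : ℝ) : ‖e x‖ = 1 := by
  rw [e_eq_exp, Complex.norm_exp_I_mul_ofReal]

lemma re_e_le_one (x : ℝ) : (e x).re ≤ 1 := (Complex.re_le_norm _).trans (norm_e x).le

lemma continuous_e : Continuous e := by
  unfold e
  fun_prop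

lemma norm_e_sub_one_le (x : ℝ) : ‖e x - 1‖ ≤ 2 * Real.pi * |x| := by
  rw [e_eq_exp]
  refine Real.norm_exp_I_mul_ofReal_sub_one_le.trans_eq ?_
  rw [Real.norm_eq_abs, abs_mul, abs_of_pos Real.two_pi_pos]

end Character

/-! ### Estimates for products and exponentials of modulus at most 1. -/

section Products

lemma norm_prod_one_add_sub_one_le {z : ℕ → ℂ} (hz : ∀ k, ‖1 + z k‖ ≤ 1) (n : ℕ) :
    ‖∏ k ∈ Finset.range n, (1 + z k) - 1‖ ≤ ∑ k ∈ Finset.range n, ‖z k‖ := by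
  induction n with
  | zero => simp
  | succ n ih =>
    rw [Finset.prod_range_succ, Finset.sum_range_succ]
    set Q := ∏ k ∈ Finset.range n, (1 + z k)
    calc ‖Q * (1 + z n) - 1‖ = ‖(Q - 1) * (1 + z n) + z n‖ := by ring_nf
      _ ≤ ‖Q - 1‖ * ‖1 + z n‖ + ‖z n‖ := (norm_add_le _ _).trans_eq (by rw [norm_mul])
      _ ≤ ‖Q - 1‖ * 1 + ‖z n‖ := by gcongr; exact hz n
      _ ≤ _ := by linarith

/-- Telescoping; factors in the unit disc keep the higher-order terms of the product from growing.
It matters that only pairs `j < k` occur: the correlation bound used after integration fails on the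
diagonal. -/
lemma norm_prod_one_add_sub_one_sub_sum_le {z : ℕ → ℂ} (hz : ∀ k, ‖1 + z k‖ ≤ 1) (n : ℕ) :
    ‖∏ k ∈ Finset.range n, (1 + z k) - 1 - ∑ k ∈ Finset.range n, z k‖ ≤
      ∑ k ∈ Finset.range n, ∑ j ∈ Finset.range k, ‖z j‖ * ‖z k‖ := by
  induction n with
  | zero => simp
  | succ n ih =>
    rw [Finset.prod_range_succ, Finset.sum_range_succ, Finset.sum_range_succ, ← Finset.sum_mul]
    have h := norm_prod_one_add_sub_one_le hz n
    set Q := ∏ k ∈ Finset.range n, (1 + z k)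
    set S := ∑ k ∈ Finset.range n, z k
    calc ‖Q * (1 + z n) - 1 - (S + z n)‖ = ‖(Q - 1 - S) + (Q - 1) * z n‖ := by ring_nf
      _ ≤ ‖Q - 1 - S‖ + ‖Q - 1‖ * ‖z n‖ := (norm_add_le _ _).trans_eq (by rw [norm_mul])
      _ ≤ _ := by gcongr

lemma sum_sum_range_mul_le_sq {x : ℕ → ℝ} (hx : ∀ k, 0 ≤ x k) (n : ℕ) :
    ∑ k ∈ Finset.range n, ∑ j ∈ Finset.range k, x j * x k ≤
      (∑ k ∈ Finset.range n, x k) ^ 2 := by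
  rw [sq, Finset.sum_mul_sum, Finset.sum_comm]
  refine Finset.sum_le_sum fun k hk => ?_
  refine Finset.sum_le_sum_of_subset_of_nonneg ?_ fun j _ _ => mul_nonneg (hx j) (hx k)
  exact Finset.range_subset_range.2 (Finset.mem_range.1 hk).le

lemma norm_exp_le_one {z : ℂ} (hz : z.re ≤ 0) : ‖Complex.exp z‖ ≤ 1 := by
  rw [Complex.norm_exp]
  exact Real.exp_le_one_iff.2 hz

/-- Mean value inequality on the convex left half-plane, where the derivative of `exp` has modulus
at most 1. -/
lemma norm_exp_sub_exp_le {a b : ℂ} (ha : a.re ≤ 0) (hb : b.re ≤ 0) :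
    ‖Complex.exp a - Complex.exp b‖ ≤ ‖a - b‖ := by
  have h := Convex.norm_image_sub_le_of_norm_hasDerivWithin_le (s := {z : ℂ | z.re ≤ 0})
    (f := Complex.exp) (f' := Complex.exp) (C := 1) (x := b) (y := a)
    (fun z _ => (Complex.hasDerivAt_exp z).hasDerivWithinAt)
    (fun z hz => norm_exp_le_one hz)
    (convex_halfSpace_le Complex.reLm.isLinear 0) hb ha
  simpa using h

end Products

/-! ### Digit probabilities and expectations of products. -/

section Moments

variable {T : EllTwo →L[ℂ] EllTwo} {μ : Measure BinarySeq}

lemma entry_self_nonneg (h0 : 0 ≤ T) (k : ℕ) : 0 ≤ entry T k k :=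
  (compression_posSemidef h0 fun _ : Unit => k).diag_nonneg (i := ())

/-- Frees the cylinder formula from `Finset` indices, so that it applies to `Fin n`, to one index
and to a pair. -/
lemma measureReal_forall_eq (hμ : IsDeterminantalMeasure T μ) {ι : Type*} [Fintype ι]
    [DecidableEq ι] {v : ι → ℕ} (hv : Function.Injective v) (ξ : ι → Bool) :
    (μ.real {ω | ∀ i, ω (v i) = ξ i} : ℂ) = (cylMatrix (compression T v) ξ).det := by
  let F : Finset ℕ := Finset.univ.map ⟨v, hv⟩
  let g : ι ≃ F := Equiv.ofBijective (fun i => ⟨v i, by simp [F]⟩)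
    ⟨fun a b h => hv (Subtype.mk.inj h), fun ⟨k, hk⟩ => by
      obtain ⟨i, -, hi⟩ := Finset.mem_map.1 hk
      exact ⟨i, Subtype.ext hi⟩⟩
  have hset : {ω : BinarySeq | ∀ i, ω (v i) = ξ i} = cyl F (ξ ∘ g.symm) := by
    ext ω
    simp only [cyl, Set.mem_ofPred_eq, ← g.forall_congr_right, Function.comp_apply,
      Equiv.symm_apply_apply]
    rfl
  rw [hset, hμ.measure_cyl, ← Matrix.det_submatrix_equiv_self g]
  congr 1
  ext i j
  simp only [W, cylMatrix, compression, Matrix.submatrix_apply, Matrix.of_apply,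
    Function.comp_apply, Equiv.symm_apply_apply, Matrix.one_apply, g.apply_eq_iff_eq]
  rfl

lemma integrable_of_continuous [IsFiniteMeasure μ] {E : Type*} [NormedAddCommGroup E]
    {f : BinarySeq → E} (hf : Continuous f) : Integrable f μ :=
  hf.integrable_of_hasCompactSupport (HasCompactSupport.of_compactSpace f)

lemma integral_prod_apply (hμ : IsDeterminantalMeasure T μ) (n : ℕ) (w : ℕ → Bool → ℂ) :
    ∫ ω, ∏ k ∈ Finset.range n, w k (ω k) ∂μ =
      (Matrix.of fun i j : Fin n => w i false * ((1 : Matrix (Fin n) (Fin n) ℂ) i j -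
        trunc T n i j) + w i true * trunc T n i j).det := by
  have := hμ.isProbabilityMeasure
  have hρ : Measurable fun (ω : BinarySeq) (i : Fin n) => ω i :=
    measurable_pi_lambda _ fun _ => measurable_pi_apply _
  have := Measure.isProbabilityMeasure_map (μ := μ) hρ.aemeasurable
  have h1 : ∫ ω, ∏ k ∈ Finset.range n, w k (ω k) ∂μ =
      ∫ ξ, ∏ i : Fin n, w i (ξ i) ∂(μ.map fun (ω : BinarySeq) (i : Fin n) => ω i) := by
    rw [integral_map hρ.aemeasurable (Measurable.of_discrete).aestronglyMeasurable]
    simp only [Finset.prod_range]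
  rw [h1, integral_fintype .of_finite, ← sum_prod_mul_det_cylMatrix]
  refine Finset.sum_congr rfl fun ξ _ => ?_
  rw [map_measureReal_apply hρ (measurableSet_singleton ξ), mul_comm, Complex.real_smul]
  congr 1
  refine Eq.trans ?_ (measureReal_forall_eq hμ Fin.val_injective ξ)
  congr 2
  ext ω
  simp [funext_iff]

lemma measurableSet_apply_eq_true (k : ℕ) : MeasurableSet {ω : BinarySeq | ω k = true} :=
  measurableSet_eq_fun (measurable_pi_apply k) measurable_const

lemma measureReal_apply_eq_true (hμ : IsDeterminantalMeasure T μ) (k : ℕ) :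
    (μ.real {ω | ω k = true} : ℂ) = entry T k k := by
  have h := measureReal_forall_eq hμ (v := fun _ : Unit => k)
    (Function.injective_of_subsingleton _) fun _ => true
  simpa [Matrix.det_unique, cylMatrix, compression] using h

/-- Negative correlation: the probability is the minor `T_jj T_kk - |T_jk|^2`. -/
lemma measureReal_pair_le (h0 : 0 ≤ T) (hμ : IsDeterminantalMeasure T μ) {j k : ℕ} (hjk : j ≠ k) :
    μ.real {ω | ω j = true ∧ ω k = true} ≤ (entry T j j).re * (entry T k k).re := by
  have hv : Function.Injective ![j, k] := by
    intro a b
    fin_cases a <;> fin_cases b <;> simp [hjk, hjk.symm]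
  have h := measureReal_forall_eq hμ hv fun _ => true
  have hsym : entry T k j = star (entry T j k) :=
    ((compression_posSemidef h0 ![j, k]).isHermitian.apply 1 0).symm
  have hj := (Complex.nonneg_iff.1 (entry_self_nonneg h0 j)).2
  have hk := (Complex.nonneg_iff.1 (entry_self_nonneg h0 k)).2
  have h' := congrArg Complex.re h
  simp [Matrix.det_fin_two, cylMatrix, compression, hsym, ← hj, ← hk] at h'
  rw [h']
  nlinarith [sq_nonneg (entry T j k).re, sq_nonneg (entry T j k).im]

end Moments

/-! ### The Fourier transform as a limit of determinants. -/

section FourierTransform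

variable {T : EllTwo →L[ℂ] EllTwo} {μ : Measure BinarySeq} {lam : ℝ}

/-- With weights `e 0 = 1` for digit 0 and `e(lam^(k+1) t)` for digit 1, row `k` of the generating
determinant is `(1 - T) + e(lam^(k+1) t) T`, the row of `1 + D T`. -/
lemma det_one_add_eq_integral (hμ : IsDeterminantalMeasure T μ) (lam t : ℝ) (n : ℕ) :
    (1 + D lam t n * trunc T n).det =
      ∫ ω, ∏ k ∈ Finset.range n, e (t * (((ω k).toNat : ℝ) * lam ^ (k + 1))) ∂μ := by
  rw [integral_prod_apply hμ n fun k b => e (t * ((b.toNat : ℝ) * lam ^ (k + 1)))]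
  congr 1
  ext i j
  simp only [D, Matrix.add_apply, Matrix.diagonal_mul, Matrix.of_apply, Bool.toNat_false,
    Bool.toNat_true, Nat.cast_zero, Nat.cast_one, zero_mul, mul_zero, one_mul, e_zero]
  rw [mul_comm t]
  ring

lemma norm_det_one_add_le (hμ : IsDeterminantalMeasure T μ) (lam t : ℝ) (n : ℕ) :
    ‖(1 + D lam t n * trunc T n).det‖ ≤ 1 := by
  have := hμ.isProbabilityMeasure
  rw [det_one_add_eq_integral hμ]
  refine (norm_integral_le_of_norm_le_const (C := 1) (.of_forall fun ω => ?_)).trans_eq (by simp)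
  simp [norm_e]

lemma tendsto_det_one_add (hμ : IsDeterminantalMeasure T μ) (hl0 : 0 < lam) (hl1 : lam < 1)
    (t : ℝ) :
    Tendsto (fun n : ℕ => (1 + D lam t n * trunc T n).det) atTop
      (𝓝 (fourier (induced lam μ) t)) := by
  have := hμ.isProbabilityMeasure
  have hF : fourier (induced lam μ) t = ∫ ω, e (t * encode lam ω) ∂μ := by
    rw [fourier, induced, integral_map (continuous_encode hl0 hl1).aemeasurable]
    exact (continuous_e.comp (continuous_const.mul continuous_id)).aestronglyMeasurable
  rw [hF]
  simp only [det_one_add_eq_integral hμ, ← e_sum, ← Finset.mul_sum]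
  refine tendsto_integral_of_dominated_convergence (fun _ => 1) (fun n => ?_)
    (integrable_const _) (fun n => .of_forall fun ω => (norm_e _).le) (.of_forall fun ω => ?_)
  · refine (continuous_e.comp (continuous_const.mul ?_)).aestronglyMeasurable
    exact continuous_finsetSum _ fun k _ =>
      continuous_comp_apply (fun b => (b.toNat : ℝ) * lam ^ (k + 1)) k
  · exact (continuous_e.tendsto _).comp
      ((summable_digit_mul_pow hl0 hl1 ω).hasSum.tendsto_sum_nat.const_mul t)

end FourierTransform

/-! ### Size and sign of the diagonal terms. -/

section DiagonalTerms

variable {T : EllTwo →L[ℂ] EllTwo} {lam : ℝ}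

lemma entry_self_eq_re (h0 : 0 ≤ T) (k : ℕ) : entry T k k = ((entry T k k).re : ℂ) :=
  Complex.ext rfl (Complex.nonneg_iff.1 (entry_self_nonneg h0 k)).2.symm

lemma entry_self_re_nonneg (h0 : 0 ≤ T) (k : ℕ) : 0 ≤ (entry T k k).re :=
  (Complex.nonneg_iff.1 (entry_self_nonneg h0 k)).1

lemma entry_self_re_le_one (h1 : T ≤ 1) (k : ℕ) : (entry T k k).re ≤ 1 := by
  have h := entry_self_nonneg (sub_nonneg.2 h1) k
  have h' : entry (1 - T) k k = 1 - entry T k k := by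
    simp [entry]
  rw [h'] at h
  simpa using (Complex.nonneg_iff.1 h).1

lemma norm_diagTerm (h0 : 0 ≤ T) (lam t : ℝ) (k : ℕ) :
    ‖diagTerm T lam t k‖ = ‖e (lam ^ (k + 1) * t) - 1‖ * (entry T k k).re := by
  rw [diagTerm, norm_mul, entry_self_eq_re h0, Complex.norm_real, Complex.ofReal_re,
    Real.norm_of_nonneg (entry_self_re_nonneg h0 k)]

lemma diagTerm_re_nonpos (h0 : 0 ≤ T) (lam t : ℝ) (k : ℕ) : (diagTerm T lam t k).re ≤ 0 := by
  rw [diagTerm, entry_self_eq_re h0, Complex.re_mul_ofReal, Complex.sub_re, Complex.one_re]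
  exact mul_nonpos_of_nonpos_of_nonneg (sub_nonpos.2 (re_e_le_one _)) (entry_self_re_nonneg h0 k)

lemma sum_diagTerm_re_nonpos (h0 : 0 ≤ T) (lam t : ℝ) (s : Finset ℕ) :
    (∑ k ∈ s, diagTerm T lam t k).re ≤ 0 := by
  rw [Complex.re_sum]
  exact Finset.sum_nonpos fun k _ => diagTerm_re_nonpos h0 lam t k

lemma norm_diagTerm_le (h0 : 0 ≤ T) (h1 : T ≤ 1) (hl0 : 0 < lam) (t : ℝ) (k : ℕ) :
    ‖diagTerm T lam t k‖ ≤ 2 * Real.pi * |t| * lam ^ (k + 1) := by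
  rw [norm_diagTerm h0]
  calc _ ≤ ‖e (lam ^ (k + 1) * t) - 1‖ * 1 := by
        gcongr
        exact entry_self_re_le_one h1 k
    _ ≤ 2 * Real.pi * |lam ^ (k + 1) * t| := by
        rw [mul_one]
        exact norm_e_sub_one_le _
    _ = _ := by
        rw [abs_mul, abs_of_pos (pow_pos hl0 _)]
        ring

lemma summable_norm_diagTerm (h0 : 0 ≤ T) (h1 : T ≤ 1) (hl0 : 0 < lam) (hl1 : lam < 1) (t : ℝ) :
    Summable fun k => ‖diagTerm T lam t k‖ :=
  ((summable_pow_succ hl0 hl1).mul_left (2 * Real.pi * |t|)).of_nonneg_of_le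
    (fun _ => norm_nonneg _) fun k => norm_diagTerm_le h0 h1 hl0 t k

lemma tsum_norm_diagTerm_add_le (h0 : 0 ≤ T) (h1 : T ≤ 1) (hl0 : 0 < lam) (hl1 : lam < 1)
    (t : ℝ) (n : ℕ) :
    ∑' k, ‖diagTerm T lam t (k + n)‖ ≤ 2 * Real.pi * (lam ^ (n + 1) * |t| / (1 - lam)) := by
  have hg : HasSum (fun k : ℕ => 2 * Real.pi * |t| * lam ^ (n + 1) * lam ^ k)
      (2 * Real.pi * |t| * lam ^ (n + 1) * (1 - lam)⁻¹) :=
    (hasSum_geometric_of_lt_one hl0.le hl1).mul_left _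
  refine (((summable_nat_add_iff n).2 (summable_norm_diagTerm h0 h1 hl0 hl1 t)).tsum_le_tsum
    (fun k => ?_) hg.summable).trans_eq ?_
  · refine (norm_diagTerm_le h0 h1 hl0 t (k + n)).trans_eq ?_
    ring
  · rw [hg.tsum_eq]
    ring

end DiagonalTerms

/-! ### Second-order comparison with the exponential of the trace. -/

section Asymptotics

variable {T : EllTwo →L[ℂ] EllTwo} {μ : Measure BinarySeq} {lam : ℝ}

lemma e_digit_sub_one (lam t : ℝ) (k : ℕ) (b : Bool) :
    e (t * ((b.toNat : ℝ) * lam ^ (k + 1))) - 1 =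
      (b.toNat : ℂ) * (e (lam ^ (k + 1) * t) - 1) := by
  cases b
  · simp [e_zero]
  · simp [mul_comm t]

lemma integral_toNat (hμ : IsDeterminantalMeasure T μ) (k : ℕ) :
    ∫ ω, ((ω k).toNat : ℂ) ∂μ = entry T k k := by
  have hind : (fun ω : BinarySeq => ((ω k).toNat : ℂ)) =
      fun ω => (({ω : BinarySeq | ω k = true}.indicator 1 ω : ℝ) : ℂ) := by
    ext ω
    rcases h : ω k <;> simp [h]
  rw [hind, integral_complex_ofReal, integral_indicator_one (measurableSet_apply_eq_true k),
    measureReal_apply_eq_true hμ]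

lemma integral_toNat_mul_le (h0 : 0 ≤ T) (hμ : IsDeterminantalMeasure T μ) {j k : ℕ}
    (hjk : j ≠ k) :
    ∫ ω, ((ω j).toNat : ℝ) * ((ω k).toNat : ℝ) ∂μ ≤ (entry T j j).re * (entry T k k).re := by
  have hind : (fun ω : BinarySeq => ((ω j).toNat : ℝ) * ((ω k).toNat : ℝ)) =
      {ω : BinarySeq | ω j = true ∧ ω k = true}.indicator 1 := by
    ext ω
    rcases h : ω j <;> rcases h' : ω k <;> simp [h, h']
  rw [hind]
  exact (integral_indicator_one
    ((measurableSet_apply_eq_true j).inter (measurableSet_apply_eq_true k))).trans_le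
    (measureReal_pair_le h0 hμ hjk)

/-- The determinant agrees with one plus the trace up to second order. -/
lemma norm_det_one_add_sub_one_sub_sum_le (h0 : 0 ≤ T) (hμ : IsDeterminantalMeasure T μ)
    (lam t : ℝ) (n : ℕ) :
    ‖(1 + D lam t n * trunc T n).det - 1 - ∑ k ∈ Finset.range n, diagTerm T lam t k‖ ≤
      (∑ k ∈ Finset.range n, ‖diagTerm T lam t k‖) ^ 2 := by
  have := hμ.isProbabilityMeasure
  set d : ℕ → ℂ := fun k => e (lam ^ (k + 1) * t) - 1 with hd
  set z : BinarySeq → ℕ → ℂ := fun ω k => ((ω k).toNat : ℂ) * d k with hz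
  have hez : ∀ ω k, e (t * (((ω k).toNat : ℝ) * lam ^ (k + 1))) = 1 + z ω k := fun ω k =>
    eq_add_of_sub_eq' (e_digit_sub_one lam t k (ω k))
  have hzc : ∀ k, Continuous fun ω => z ω k := fun k =>
    continuous_comp_apply (fun b => (b.toNat : ℂ) * d k) k
  have hsum : ∑ k ∈ Finset.range n, diagTerm T lam t k =
      ∫ ω, ∑ k ∈ Finset.range n, z ω k ∂μ := by
    rw [integral_finsetSum _ fun k _ => integrable_of_continuous (hzc k)]
    refine Finset.sum_congr rfl fun k _ => ?_
    rw [integral_mul_const, integral_toNat hμ, diagTerm, mul_comm]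
  have hprod : Continuous fun ω => ∏ k ∈ Finset.range n, (1 + z ω k) :=
    continuous_finsetProd _ fun k _ => continuous_const.add (hzc k)
  have hsumc : Continuous fun ω => ∑ k ∈ Finset.range n, z ω k :=
    continuous_finsetSum _ fun k _ => hzc k
  have hint : (1 + D lam t n * trunc T n).det - 1 - ∑ k ∈ Finset.range n, diagTerm T lam t k =
      ∫ ω, (∏ k ∈ Finset.range n, (1 + z ω k) - 1 - ∑ k ∈ Finset.range n, z ω k) ∂μ := by
    have hprod1 : Continuous fun ω => ∏ k ∈ Finset.range n, (1 + z ω k) - 1 :=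
      hprod.sub continuous_const
    rw [integral_sub (integrable_of_continuous hprod1) (integrable_of_continuous hsumc),
      integral_sub (integrable_of_continuous hprod) (integrable_const _), ← hsum,
      det_one_add_eq_integral hμ]
    simp only [hez, integral_const, probReal_univ, one_smul]
  rw [hint]
  have hpair : ∀ j k, Integrable (fun ω : BinarySeq =>
      (((ω j).toNat : ℝ) * ((ω k).toNat : ℝ)) * (‖d j‖ * ‖d k‖)) μ := fun j k =>
    integrable_of_continuous (((continuous_comp_apply (fun b => (b.toNat : ℝ)) j).mul
      (continuous_comp_apply (fun b => (b.toNat : ℝ)) k)).mul continuous_const)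
  -- The bound is pointwise in `ω` and keeps the digits, so that the pair probabilities, and with
  -- them the factors `T_jj T_kk`, appear on integrating.
  have hpt : ∀ ω, ‖∏ k ∈ Finset.range n, (1 + z ω k) - 1 - ∑ k ∈ Finset.range n, z ω k‖ ≤
      ∑ k ∈ Finset.range n, ∑ j ∈ Finset.range k,
        (((ω j).toNat : ℝ) * ((ω k).toNat : ℝ)) * (‖d j‖ * ‖d k‖) := fun ω => by
    refine (norm_prod_one_add_sub_one_sub_sum_le (z := z ω)
      (fun k => by rw [← hez, norm_e]) n).trans_eq ?_
    refine Finset.sum_congr rfl fun k _ => Finset.sum_congr rfl fun j _ => ?_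
    simp only [hz, norm_mul, Complex.norm_natCast]
    ring
  refine (norm_integral_le_of_norm_le ?_ (.of_forall hpt)).trans ?_
  · exact integrable_finsetSum _ fun k _ => integrable_finsetSum _ fun j _ => hpair j k
  rw [integral_finsetSum _ fun k _ => integrable_finsetSum _ fun j _ => hpair j k]
  refine le_trans (Finset.sum_le_sum fun k _ => ?_)
    (sum_sum_range_mul_le_sq (fun k => norm_nonneg (diagTerm T lam t k)) n)
  rw [integral_finsetSum _ fun j _ => hpair j k]
  refine Finset.sum_le_sum fun j hj => ?_
  rw [integral_mul_const, norm_diagTerm h0, norm_diagTerm h0]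
  calc _ ≤ (entry T j j).re * (entry T k k).re * (‖d j‖ * ‖d k‖) := by
        gcongr
        exact integral_toNat_mul_le h0 hμ (Finset.mem_range.1 hj).ne
    _ = _ := by ring

/-- If the sum `X` of moduli is at most 1, both the determinant and the exponential are within `X^2`
of `1 + S`. If `X ≥ 1`, both have modulus at most 1, so their distance is at most `2 ≤ 2 X^2`. -/
lemma norm_det_one_add_sub_exp_le (h0 : 0 ≤ T) (hμ : IsDeterminantalMeasure T μ)
    (lam t : ℝ) (n : ℕ) :
    ‖(1 + D lam t n * trunc T n).det -
        Complex.exp (∑ k ∈ Finset.range n, diagTerm T lam t k)‖ ≤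
      2 * (∑ k ∈ Finset.range n, ‖diagTerm T lam t k‖) ^ 2 := by
  have hS := norm_sum_le (Finset.range n) (diagTerm T lam t)
  have hre := sum_diagTerm_re_nonpos h0 lam t (Finset.range n)
  have hdet := norm_det_one_add_sub_one_sub_sum_le h0 hμ lam t n
  have hdet1 := norm_det_one_add_le hμ lam t n
  set S := ∑ k ∈ Finset.range n, diagTerm T lam t k
  set X := ∑ k ∈ Finset.range n, ‖diagTerm T lam t k‖
  set δ := (1 + D lam t n * trunc T n).det
  rcases le_total X 1 with hX | hX
  · have hexp := Complex.norm_exp_sub_one_sub_id_le (hS.trans hX)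
    have hS2 : ‖S‖ ^ 2 ≤ X ^ 2 := by gcongr
    calc ‖δ - Complex.exp S‖ = ‖(δ - 1 - S) - (Complex.exp S - 1 - S)‖ := by ring_nf
      _ ≤ ‖δ - 1 - S‖ + ‖Complex.exp S - 1 - S‖ := norm_sub_le _ _
      _ ≤ _ := by linarith
  · have hexp := norm_exp_le_one hre
    refine (norm_sub_le _ _).trans ?_
    nlinarith

lemma norm_fourier_sub_exp_tsum_le (h0 : 0 ≤ T) (h1 : T ≤ 1) (hμ : IsDeterminantalMeasure T μ)
    (hl0 : 0 < lam) (hl1 : lam < 1) (t : ℝ) :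
    ‖fourier (induced lam μ) t - Complex.exp (∑' k, diagTerm T lam t k)‖ ≤
      2 * (∑' k, ‖diagTerm T lam t k‖) ^ 2 := by
  have hs := summable_norm_diagTerm h0 h1 hl0 hl1 t
  refine le_of_tendsto_of_tendsto' (((tendsto_det_one_add hμ hl0 hl1 t).sub
    ((Complex.continuous_exp.tendsto _).comp hs.of_norm.hasSum.tendsto_sum_nat)).norm)
    ((hs.hasSum.tendsto_sum_nat.pow 2).const_mul 2)
    fun n => norm_det_one_add_sub_exp_le h0 hμ lam t n

lemma norm_exp_tsum_sub_exp_sum_le (h0 : 0 ≤ T) (h1 : T ≤ 1) (hl0 : 0 < lam) (hl1 : lam < 1)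
    (t : ℝ) (n : ℕ) :
    ‖Complex.exp (∑' k, diagTerm T lam t k) -
        Complex.exp (∑ k ∈ Finset.range n, diagTerm T lam t k)‖ ≤
      2 * Real.pi * (lam ^ (n + 1) * |t| / (1 - lam)) := by
  have hs := summable_norm_diagTerm h0 h1 hl0 hl1 t
  have hre : (∑' k, diagTerm T lam t k).re ≤ 0 := by
    rw [Complex.re_tsum hs.of_norm]
    exact tsum_nonpos fun k => diagTerm_re_nonpos h0 lam t k
  refine (norm_exp_sub_exp_le hre (sum_diagTerm_re_nonpos h0 lam t _)).trans ?_
  have htail : ∑' k, diagTerm T lam t k - ∑ k ∈ Finset.range n, diagTerm T lam t k =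
      ∑' k, diagTerm T lam t (k + n) :=
    sub_eq_of_eq_add' (hs.of_norm.sum_add_tsum_nat_add n).symm
  rw [htail]
  have hsn : Summable fun k => ‖diagTerm T lam t (k + n)‖ := (summable_nat_add_iff n).2 hs
  exact (norm_tsum_le_tsum_norm hsn).trans
    (tsum_norm_diagTerm_add_le h0 h1 hl0 hl1 t n)

lemma norm_fourier_sub_exp_sum_le (h0 : 0 ≤ T) (h1 : T ≤ 1) (hμ : IsDeterminantalMeasure T μ)
    (hl0 : 0 < lam) (hl1 : lam < 1) (t : ℝ) (n : ℕ) :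
    ‖fourier (induced lam μ) t -
        Complex.exp (∑ k ∈ Finset.range n, diagTerm T lam t k)‖ ≤
      8 * Real.pi ^ 2 *
        ((lam * |t| / (1 - lam)) ^ 2 + lam ^ (n + 1) * |t| / (1 - lam)) := by
  have hA := norm_fourier_sub_exp_tsum_le h0 h1 hμ hl0 hl1 t
  have hB := norm_exp_tsum_sub_exp_sum_le h0 h1 hl0 hl1 t n
  have hX : ∑' k, ‖diagTerm T lam t k‖ ≤ 2 * Real.pi * (lam * |t| / (1 - lam)) := by
    simpa using tsum_norm_diagTerm_add_le h0 h1 hl0 hl1 t 0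
  have hX0 : 0 ≤ ∑' k, ‖diagTerm T lam t k‖ := tsum_nonneg fun _ => norm_nonneg _
  have hX2 := pow_le_pow_left₀ hX0 hX 2
  have hY : 0 ≤ lam ^ (n + 1) * |t| / (1 - lam) :=
    div_nonneg (by positivity) (sub_nonneg.2 hl1.le)
  -- The square term has coefficient `2 (2π)^2 = 8π^2` and the tail has `2π`; the larger serves
  -- both.
  have hpi : 2 * Real.pi ≤ 8 * Real.pi ^ 2 := by nlinarith [Real.pi_gt_three]
  have hY2 := mul_le_mul_of_nonneg_right hpi hY
  have htri := norm_sub_le_norm_sub_add_norm_sub (fourier (induced lam μ) t)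
    (Complex.exp (∑' k, diagTerm T lam t k))
    (Complex.exp (∑ k ∈ Finset.range n, diagTerm T lam t k))
  rw [mul_pow, mul_pow] at hX2
  rw [mul_add]
  linarith

end Asymptotics

end DetFourier

theorem mainTheorem7 :
    ∃ C : ℝ, ∀ (T : DetFourier.EllTwo →L[ℂ] DetFourier.EllTwo), 0 ≤ T → T ≤ 1 →
      (∃! μ : Measure DetFourier.BinarySeq, DetFourier.IsDeterminantalMeasure T μ) ∧
      ∀ lam : ℝ, 0 < lam → lam < 1 →
        (∀ p : DetFourier.BinarySeq → ℝ,
          DetFourier.IsEncodingMap lam p ↔ p = DetFourier.encode lam) ∧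
        ∀ μ : Measure DetFourier.BinarySeq, DetFourier.IsDeterminantalMeasure T μ →
        ∀ t : ℝ,
          -- the limit formula for the Fourier transform
          Tendsto (fun n : ℕ => (1 + DetFourier.D lam t n * DetFourier.trunc T n).det) atTop
            (𝓝 (DetFourier.fourier (DetFourier.induced lam μ) t)) ∧
          -- the exponential asymptotics, up to second order, at every stage `n`
          (∀ n : ℕ,
            ‖(1 + DetFourier.D lam t n * DetFourier.trunc T n).det -
                Complex.exp (∑ k ∈ Finset.range n, DetFourier.diagTerm T lam t k)‖ ≤
              C * (∑ k ∈ Finset.range n, ‖DetFourier.diagTerm T lam t k‖) ^ 2) ∧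
          -- and in the limit `n → ∞`
          Summable (fun k : ℕ => ‖DetFourier.diagTerm T lam t k‖) ∧
          ‖DetFourier.fourier (DetFourier.induced lam μ) t -
              Complex.exp (∑' k : ℕ, DetFourier.diagTerm T lam t k)‖ ≤
            C * (∑' k : ℕ, ‖DetFourier.diagTerm T lam t k‖) ^ 2 ∧
          (∀ n : ℕ,
            ‖DetFourier.fourier (DetFourier.induced lam μ) t -
                Complex.exp (∑ k ∈ Finset.range n, DetFourier.diagTerm T lam t k)‖ ≤
              C * ((lam * |t| / (1 - lam)) ^ 2 + lam ^ (n + 1) * |t| / (1 - lam))) := by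
  have hC : (2 : ℝ) ≤ 8 * Real.pi ^ 2 := by nlinarith [Real.pi_gt_three]
  refine ⟨8 * Real.pi ^ 2, fun T h0 h1 =>
    ⟨DetFourier.existsUnique_isDeterminantalMeasure h0 h1, fun lam hl0 hl1 =>
      ⟨DetFourier.isEncodingMap_iff hl0 hl1, fun μ hμ t =>
        ⟨DetFourier.tendsto_det_one_add hμ hl0 hl1 t, fun n => ?_,
          DetFourier.summable_norm_diagTerm h0 h1 hl0 hl1 t, ?_,
          DetFourier.norm_fourier_sub_exp_sum_le h0 h1 hμ hl0 hl1 t⟩⟩⟩⟩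
  · exact (DetFourier.norm_det_one_add_sub_exp_le h0 hμ lam t n).trans
      (mul_le_mul_of_nonneg_right hC (sq_nonneg _))
  · exact (DetFourier.norm_fourier_sub_exp_tsum_le h0 h1 hμ hl0 hl1 t).trans
      (mul_le_mul_of_nonneg_right hC (sq_nonneg _))
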